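/- For integers $n\ge 1$ and $k\ge 2$ let $\mathcal F_{n,k}$ be the set of binary words $w_1\cdots w_n$ that do not contain $k$ consecutive $1$'s. To such a word associate the bargraph polyomino with $n$ columns whose $i$-th column has $w_i+1$ unit cells ($1\le i\le n$), and the graph whose vertices are the corners of the cells of this polyomino and whose edges are the sides of its cells. Let $\mathcal G_{n,k}$ be the family of the graphs obtained in this way, one for each word of $\mathcal F_{n,k}$ (isomorphic graphs that come from different words are counted separately). Put $\mathrm{Ham}(G)=1$ if $G$ has a Hamiltonian cycle (a cycle that visits each vertex exactly once), and $\mathrm{Ham}(G)=0$ otherwise, and let $$H_k(x,q)=\sum_{n\ge 1}x^n\sum_{G\in\mathcal G_{n,k}}q^{\mathrm{Ham}(G)}\in\mathbb Z[q][[x]].$$ **Theorem.** For all $k\ge 2$, $$H_k(x,q)=\frac{x\left((1-x)\,x\,\bigl(1-x^{2\lfloor (k-1)/2\rfloor}\bigr)-q\,(1+x)\,(1-2x+x^{k+1})\,\bigl(-2+x+x^{2\lfloor k/2\rfloor}\bigr)\right)}{(1-2x+x^{k+1})\left(1-x-2x^2+x^3+x^{2(1+\lfloor k/2\rfloor)}\right)},$$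 where the denominator is invertible in $\mathbb Z[q][[x]]$. -/

import Mathlib

/-- The binary words `w = w₁ ⋯ wₙ` of length `n` that avoid `k` consecutive `1`'s
(the generalized `k`-bonacci words of length `n`). -/
def kBonacciWords (n k : ℕ) : Finset (Fin n → Fin 2) :=
  Finset.univ.filter fun w => ¬ List.replicate k (1 : Fin 2) <:+: List.ofFn w

/-- The bargraph of a binary word: its `i`-th column consists of `w i + 1` unit cells.
The pair `(i, r)` stands for the unit cell `[i, i + 1] × [r, r + 1]`. -/
def wordPolyomino {n : ℕ} (w : Fin n → Fin 2) : Finset (ℕ × ℕ) :=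
  Finset.univ.biUnion fun i : Fin n =>
    (Finset.range ((w i : ℕ) + 1)).image fun r => ((i : ℕ), r)

/-- The set of `k`-bonacci polyominoes with `n` columns. -/
def kBonacciPolyominoes (n k : ℕ) : Finset (Finset (ℕ × ℕ)) :=
  (kBonacciWords n k).image wordPolyomino

/-- The four corners of a unit cell. -/
def cellCorners (c : ℕ × ℕ) : Finset (ℕ × ℕ) :=
  {(c.1, c.2), (c.1 + 1, c.2), (c.1, c.2 + 1), (c.1 + 1, c.2 + 1)}

/-- The four sides (bottom, top, left, right) of a unit cell, as unordered pairs of corners. -/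
def cellSides (c : ℕ × ℕ) : Finset (Sym2 (ℕ × ℕ)) :=
  {s((c.1, c.2), (c.1 + 1, c.2)), s((c.1, c.2 + 1), (c.1 + 1, c.2 + 1)),
    s((c.1, c.2), (c.1, c.2 + 1)), s((c.1 + 1, c.2), (c.1 + 1, c.2 + 1))}

/-- The graph of a polyomino: the vertices are the corners of its cells and the edges are the
sides of its cells. -/
def polyominoGraph (P : Finset (ℕ × ℕ)) : SimpleGraph {v : ℕ × ℕ // v ∈ P.biUnion cellCorners} where
  Adj u v := s((u : ℕ × ℕ), (v : ℕ × ℕ)) ∈ P.biUnion cellSides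
  symm := ⟨fun u v h => by rwa [Sym2.eq_swap]⟩
  loopless := ⟨fun u h => by
    simp [cellSides] at h
    grind⟩

open Classical in
/-- `1` if the graph has a Hamiltonian cycle and `0` otherwise. -/
noncomputable def hamIndicator {V : Type*} [DecidableEq V] (G : SimpleGraph V) : ℕ :=
  if ∃ (a : V) (p : G.Walk a a), p.IsHamiltonianCycle then 1 else 0

/-- The generating function `H_k(x, q) = ∑_{n ≥ 1} xⁿ ∑_G q ^ Ham(G)`, where `G` runs over the
graphs of the `k`-bonacci polyominoes with `n` columns, as a formal power series in `x` whose
coefficients are polynomials in `q`. -/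
noncomputable def hamiltonianGF (k : ℕ) : PowerSeries (Polynomial ℤ) :=
  PowerSeries.mk fun n =>
    if n = 0 then 0
    else ∑ P ∈ kBonacciPolyominoes n k,
      (Polynomial.X : Polynomial ℤ) ^ hamIndicator (polyominoGraph P)

/-! The graph of a nonempty word has a Hamiltonian cycle exactly when every maximal run of `1`s has
odd length.

Necessity: give the vertices on a vertical grid line alternating signs by height and sum their
degrees in the cycle. Vertical edges cancel, so the alternating sums `S x` of the horizontal edges
entering line `x` satisfy `S x + S (x + 1) = 2` if the line reaches height 2, and `= 0` otherwise.
Hence `S` alternates between 0 and 2 along a run, and a run of even length would force the value 2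
just after it, where at most 1 is possible (`IsBargraph.runsIn_odd_of_isHamiltonianCycle`).
Sufficiency: traverse the bottom row one way and return by a zigzag through the other vertices
(`IsBargraph.exists_isHamiltonianCycle`).

Since `q ^ Ham = 1 + (q - 1) * Ham`, it remains to count words with run lengths below `k`, and those
whose nonzero run lengths are moreover odd. If `s` is the sum of `X ^ c` over the allowed lengths
`c`, the series `G` of such words satisfies `G = (1 + X * G) * s` (`runGF_zero_eq_sum`). -/

/-! ### Runs of ones in binary words -/

/-- In `1 ^ c` followed by the word `l`, every maximal run of `1`s has its length in `S`
(where a `0` that does not follow a `1` counts as the end of a run of length `0`). -/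
def RunsIn (S : ℕ → Prop) : ℕ → List (Fin 2) → Prop
  | c, [] => S c
  | c, a :: l => if a = 1 then RunsIn S (c + 1) l else S c ∧ RunsIn S 0 l

theorem runsIn_one_cons {S : ℕ → Prop} {c : ℕ} {l : List (Fin 2)} :
    RunsIn S c (1 :: l) ↔ RunsIn S (c + 1) l := by simp [RunsIn]

theorem runsIn_zero_cons {S : ℕ → Prop} {c : ℕ} {l : List (Fin 2)} :
    RunsIn S c (0 :: l) ↔ S c ∧ RunsIn S 0 l := by simp [RunsIn]

theorem RunsIn.and_iff {S T : ℕ → Prop} {c : ℕ} {l : List (Fin 2)} :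
    RunsIn (fun i => S i ∧ T i) c l ↔ RunsIn S c l ∧ RunsIn T c l := by
  induction l generalizing c with
  | nil => rfl
  | cons a l ih => simp only [RunsIn, ih]; grind

theorem not_runsIn_of_le {S : ℕ → Prop} {k : ℕ} (hS : ∀ c, k ≤ c → ¬ S c) {c : ℕ} (hc : k ≤ c)
    (l : List (Fin 2)) : ¬ RunsIn S c l := by
  induction l generalizing c with
  | nil => exact hS c hc
  | cons a l ih =>
    have := hS c hc
    have := ih (c := c + 1) (by omega)
    simp only [RunsIn]
    grind

/-- A block of `a`s cannot contain the separator `b`, so it lies on one side of it. -/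
theorem replicate_infix_append_cons {α : Type*} {a b : α} (hab : b ≠ a) (k : ℕ) (l₁ l₂ : List α) :
    List.replicate k a <:+: l₁ ++ b :: l₂ ↔
      List.replicate k a <:+: l₁ ∨ List.replicate k a <:+: l₂ := by
  constructor
  · rintro ⟨s, t, h⟩
    rw [List.append_assoc, List.append_eq_append_iff] at h
    obtain ⟨u, rfl, h⟩ | ⟨u, rfl, h⟩ := h
    · rw [List.append_eq_append_iff] at h
      obtain ⟨v, rfl, h⟩ | ⟨v, h, h'⟩ := h
      · exact Or.inl ⟨s, v, by simp⟩
      · cases v with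
        | nil => exact Or.inl ⟨s, [], by simp_all⟩
        | cons x v =>
          simp only [List.cons_append, List.cons.injEq] at h'
          have : b ∈ List.replicate k a := by rw [h, h'.1]; simp
          exact absurd (List.eq_of_mem_replicate this) hab
    · cases u with
      | nil =>
        cases k with
        | zero => exact Or.inl ⟨[], l₁, by simp⟩
        | succ k =>
          simp only [List.nil_append, List.replicate_succ, List.cons_append, List.cons.injEq] at h
          exact absurd h.1 hab
      | cons x u =>
        simp only [List.cons_append, List.cons.injEq] at h
        exact Or.inr ⟨u, t, by simp [h.2]⟩
  · rintro (h | h)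
    · exact h.trans (List.prefix_append _ _).isInfix
    · exact h.trans ⟨l₁ ++ [b], [], by simp⟩

theorem runsIn_lt_iff (k c : ℕ) (l : List (Fin 2)) :
    RunsIn (· < k) c l ↔ ¬ List.replicate k (1 : Fin 2) <:+: List.replicate c 1 ++ l := by
  have hrep (c : ℕ) : List.replicate k (1 : Fin 2) <:+: List.replicate c 1 ↔ k ≤ c := by
    constructor
    · intro h; simpa using h.length_le
    · intro h; exact ⟨[], List.replicate (c - k) 1, by simp [h]⟩
  induction l generalizing c with
  | nil => simp [RunsIn, hrep]
  | cons a l ih =>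
    have ih (c : ℕ) : RunsIn (· < k) c l ↔
        ¬ List.replicate k (1 : Fin 2) <:+: List.replicate c 1 ++ l := ih c
    obtain rfl | rfl : a = 0 ∨ a = 1 := by omega
    · rw [runsIn_zero_cons, ih 0, replicate_infix_append_cons (by decide), hrep]
      simp
    · rw [runsIn_one_cons, ih (c + 1), List.replicate_succ', List.append_assoc]
      rfl

theorem mem_kBonacciWords {n k : ℕ} {w : Fin n → Fin 2} :
    w ∈ kBonacciWords n k ↔ RunsIn (· < k) 0 (List.ofFn w) := by
  simp [kBonacciWords, runsIn_lt_iff]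

/-! ### Generating functions for words with prescribed run lengths -/

open Classical in
/-- The number of words `w` of length `n` such that all runs of `1 ^ c w` have length in `S`. -/
noncomputable def runCount (S : ℕ → Prop) (c n : ℕ) : ℕ :=
  (Finset.univ.filter fun w : Fin n → Fin 2 => RunsIn S c (List.ofFn w)).card

open Classical in
theorem runCount_zero (S : ℕ → Prop) (c : ℕ) : runCount S c 0 = if S c then 1 else 0 := by
  by_cases h : S c <;> simp [runCount, RunsIn, h]

open Classical in
theorem runCount_succ (S : ℕ → Prop) (c n : ℕ) :
    runCount S c (n + 1) = (if S c then runCount S 0 n else 0) + runCount S (c + 1) n := by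
  unfold runCount
  simp only [Finset.card_filter]
  rw [← (Fin.consEquiv fun _ => Fin 2).sum_comp, Fintype.sum_prod_type,
    Fin.sum_univ_two]
  have hcons (a : Fin 2) (y : Fin n → Fin 2) :
      List.ofFn ((Fin.consEquiv fun _ => Fin 2) (a, y)) = a :: List.ofFn y := List.ofFn_cons a y
  simp only [hcons, runsIn_one_cons, runsIn_zero_cons]
  by_cases h : S c <;> simp [h]

/-- The generating function of `runCount S c`. -/
noncomputable def runGF (S : ℕ → Prop) (c : ℕ) : PowerSeries (Polynomial ℤ) :=
  PowerSeries.mk fun n => (runCount S c n : Polynomial ℤ)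

theorem runGF_eq (S : ℕ → Prop) [DecidablePred S] (c : ℕ) :
    runGF S c = (if S c then 1 else 0) * (1 + PowerSeries.X * runGF S 0)
      + PowerSeries.X * runGF S (c + 1) := by
  ext1 n
  cases n with
  | zero => by_cases h : S c <;> simp [runGF, runCount_zero, h]
  | succ n =>
    by_cases h : S c <;>
      simp [runGF, runCount_succ, h, PowerSeries.coeff_succ_X_mul, PowerSeries.coeff_one]

/-- A word is an initial run `1 ^ c` followed by nothing or by `0` and another word. The recursion
`runGF_eq` is unrolled `k` times; the remainder vanishes because a run that has reached length `k`
can no longer end admissibly. -/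
theorem runGF_zero_eq_sum (S : ℕ → Prop) [DecidablePred S] (k : ℕ) (hS : ∀ c, k ≤ c → ¬ S c) :
    runGF S 0 = (1 + PowerSeries.X * runGF S 0) *
      ∑ c ∈ Finset.range k, if S c then PowerSeries.X ^ c else 0 := by
  have key (j : ℕ) : runGF S 0 = (1 + PowerSeries.X * runGF S 0) *
      (∑ c ∈ Finset.range j, if S c then PowerSeries.X ^ c else 0)
        + PowerSeries.X ^ j * runGF S j := by
    induction j with
    | zero => simp
    | succ j ih =>
      rw [Finset.sum_range_succ]
      have h := runGF_eq S j
      split_ifs at h ⊢ <;> linear_combination ih + PowerSeries.X ^ j * h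
  have hk : runGF S k = 0 := by
    ext1 n
    simp [runGF, runCount, not_runsIn_of_le hS le_rfl]
  simpa [hk] using key k

theorem runGF_lt_mul (k : ℕ) :
    runGF (· < k) 0 * (1 - 2 * PowerSeries.X + PowerSeries.X ^ (k + 1))
      = 1 - PowerSeries.X ^ k := by
  have h := runGF_zero_eq_sum (· < k) k (by simp)
  have hs : (∑ c ∈ Finset.range k,
      if c < k then (PowerSeries.X : PowerSeries (Polynomial ℤ)) ^ c else 0)
        = ∑ c ∈ Finset.range k, PowerSeries.X ^ c :=
    Finset.sum_congr rfl fun c hc => if_pos (Finset.mem_range.1 hc)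
  have hg := mul_neg_geom_sum (PowerSeries.X : PowerSeries (Polynomial ℤ)) k
  rw [hs] at h
  linear_combination (1 - PowerSeries.X) * h + (1 + PowerSeries.X * runGF (· < k) 0) * hg

/-- The sum telescopes; `1 + 2 * (k / 2)` is the least odd number that is at least `k`. -/
theorem one_sub_sq_mul_sum_odd {R : Type*} [CommRing R] (x : R) (k : ℕ) :
    (1 - x ^ 2) * (∑ c ∈ Finset.range k, if Odd c then x ^ c else 0)
      = x - x ^ (1 + 2 * (k / 2)) := by
  induction k with
  | zero => simp
  | succ k ih =>
    rw [Finset.sum_range_succ, mul_add, ih]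
    obtain ⟨m, rfl | rfl⟩ := k.even_or_odd'
    · rw [if_neg (by simp), show (2 * m + 1) / 2 = 2 * m / 2 by omega]; ring
    · rw [if_pos (by simp), show (2 * m + 1 + 1) / 2 = m + 1 by omega,
        show (2 * m + 1) / 2 = m by omega]; ring

theorem runGF_odd_mul (k : ℕ) (hk : 1 ≤ k) :
    runGF (fun c => c < k ∧ (c = 0 ∨ Odd c)) 0 * (1 - PowerSeries.X - 2 * PowerSeries.X ^ 2
        + PowerSeries.X ^ 3 + PowerSeries.X ^ (2 * (1 + k / 2)))
      = 1 + PowerSeries.X - PowerSeries.X ^ 2 - PowerSeries.X ^ (1 + 2 * (k / 2)) := by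
  have h := runGF_zero_eq_sum (fun c => c < k ∧ (c = 0 ∨ Odd c)) k (by grind)
  have hs : (∑ c ∈ Finset.range k, if c < k ∧ (c = 0 ∨ Odd c)
      then (PowerSeries.X : PowerSeries (Polynomial ℤ)) ^ c else 0)
        = 1 + ∑ c ∈ Finset.range k, if Odd c then PowerSeries.X ^ c else 0 := by
    obtain ⟨k, rfl⟩ := Nat.exists_eq_add_of_le' hk
    rw [Finset.sum_range_succ', Finset.sum_range_succ', add_comm]
    simp only [add_pos_iff, zero_lt_one, or_true, true_or, and_self, if_true, pow_zero,
      Nat.not_odd_zero, if_false, add_zero]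
    congr 1
    refine Finset.sum_congr rfl fun c hc => ?_
    have := Finset.mem_range.1 hc
    simp [this]
  have hg := one_sub_sq_mul_sum_odd (PowerSeries.X : PowerSeries (Polynomial ℤ)) k
  rw [hs] at h
  linear_combination (1 - PowerSeries.X ^ 2) * h +
    (1 + PowerSeries.X * runGF (fun c => c < k ∧ (c = 0 ∨ Odd c)) 0) * hg

/-! ### Vertices and edges of a bargraph -/

theorem mem_cellSides {a b c d i r : ℕ} : s((a, b), (c, d)) ∈ cellSides (i, r) ↔
    (b = d ∧ (b = r ∨ b = r + 1) ∧ (a = i ∧ c = i + 1 ∨ c = i ∧ a = i + 1)) ∨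
      (a = c ∧ (a = i ∨ a = i + 1) ∧ (b = r ∧ d = r + 1 ∨ d = r ∧ b = r + 1)) := by
  simp only [cellSides, Finset.mem_insert, Finset.mem_singleton, Sym2.eq_iff, Prod.mk.injEq]
  omega

theorem horizontal_mem_sides {P : Finset (ℕ × ℕ)} {x y : ℕ} :
    s((x, y), (x + 1, y)) ∈ P.biUnion cellSides ↔
      (x, y) ∈ P ∨ ∃ r, y = r + 1 ∧ (x, r) ∈ P := by
  simp only [Finset.mem_biUnion, Prod.exists, mem_cellSides]
  constructor
  · rintro ⟨i, r, h, h'⟩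
    obtain rfl : x = i := by omega
    obtain rfl | rfl : y = r ∨ y = r + 1 := by omega
    · exact Or.inl h
    · exact Or.inr ⟨r, rfl, h⟩
  · rintro (h | ⟨r, rfl, h⟩)
    · exact ⟨x, y, h, by simp⟩
    · exact ⟨x, r, h, by simp⟩

theorem vertical_mem_sides {P : Finset (ℕ × ℕ)} {x y : ℕ} :
    s((x, y), (x, y + 1)) ∈ P.biUnion cellSides ↔
      (x, y) ∈ P ∨ ∃ i, x = i + 1 ∧ (i, y) ∈ P := by
  simp only [Finset.mem_biUnion, Prod.exists, mem_cellSides]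
  constructor
  · rintro ⟨i, r, h, h'⟩
    obtain rfl : y = r := by omega
    obtain rfl | rfl : x = i ∨ x = i + 1 := by omega
    · exact Or.inl h
    · exact Or.inr ⟨i, rfl, h⟩
  · rintro (h | ⟨r, rfl, h⟩)
    · exact ⟨x, y, h, by simp⟩
    · exact ⟨r, y, h, by simp⟩

theorem mem_corners {P : Finset (ℕ × ℕ)} {x y : ℕ} : (x, y) ∈ P.biUnion cellCorners ↔
    ∃ i r, (i, r) ∈ P ∧ (x = i ∨ x = i + 1) ∧ (y = r ∨ y = r + 1) := by
  simp only [Finset.mem_biUnion, Prod.exists, cellCorners, Finset.mem_insert,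
    Finset.mem_singleton, Prod.mk.injEq]
  refine exists_congr fun i => exists_congr fun r => and_congr_right fun _ => ?_
  omega

/-- `P` is the bargraph of the word `l`. -/
def IsBargraph (P : Finset (ℕ × ℕ)) (l : List (Fin 2)) : Prop :=
  ∀ i r, (i, r) ∈ P ↔ r = 0 ∧ i < l.length ∨ r = 1 ∧ l[i]? = some 1

theorem IsBargraph.mem_corners {P : Finset (ℕ × ℕ)} {l : List (Fin 2)} (hP : IsBargraph P l)
    (hl : l ≠ []) {x y : ℕ} : (x, y) ∈ P.biUnion cellCorners ↔
      y ≤ 1 ∧ x ≤ l.length ∨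
        y = 2 ∧ (l[x]? = some 1 ∨ ∃ i, x = i + 1 ∧ l[i]? = some 1) := by
  have hlt (i : ℕ) (h : l[i]? = some 1) : i < l.length := (List.getElem?_eq_some_iff.1 h).1
  have hpos := List.length_pos_iff.2 hl
  rw [_root_.mem_corners]
  constructor
  · rintro ⟨i, r, h, hx, hy⟩
    rw [hP] at h
    obtain ⟨rfl, h⟩ | ⟨rfl, h⟩ := h
    · omega
    · have := hlt i h
      obtain rfl | rfl := hy
      · omega
      · refine Or.inr ⟨rfl, ?_⟩
        obtain rfl | rfl := hx
        · exact Or.inl h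
        · exact Or.inr ⟨i, rfl, h⟩
  · rintro (⟨hy, hx⟩ | ⟨rfl, h | ⟨i, rfl, h⟩⟩)
    · obtain h | h := hx.lt_or_eq
      · exact ⟨x, 0, (hP _ _).2 (Or.inl ⟨rfl, h⟩), by omega⟩
      · exact ⟨x - 1, 0, (hP _ _).2 (Or.inl ⟨rfl, by omega⟩), by omega⟩
    · exact ⟨x, 1, (hP _ _).2 (Or.inr ⟨rfl, h⟩), by omega⟩
    · exact ⟨i, 1, (hP _ _).2 (Or.inr ⟨rfl, h⟩), by omega⟩

/-! ### Necessity: alternating degree sums -/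

open Classical in
/-- The indicator of the horizontal edge from `(x - 1, y)` to `(x, y)` in the relation `A`. -/
noncomputable def leftEdge (A : ℕ × ℕ → ℕ × ℕ → Prop) : ℕ → ℕ → ℤ
  | 0, _ => 0
  | x + 1, y => if A (x, y) (x + 1, y) then 1 else 0

open Classical in
/-- The indicator of the vertical edge from `(x, y - 1)` to `(x, y)` in the relation `A`. -/
noncomputable def lowerEdge (A : ℕ × ℕ → ℕ × ℕ → Prop) : ℕ → ℕ → ℤ
  | _, 0 => 0
  | x, y + 1 => if A (x, y) (x, y + 1) then 1 else 0

/-- Each of the four grid directions contributes its indicator; the value 0 on the axes keeps the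
formula uniform there. -/
theorem ncard_neighbors_eq {A : ℕ × ℕ → ℕ × ℕ → Prop} (hsymm : ∀ u v, A u v → A v u)
    (hgrid : ∀ a b c d, A (a, b) (c, d) →
      (c = a + 1 ∧ d = b) ∨ (a = c + 1 ∧ d = b) ∨ (c = a ∧ d = b + 1) ∨ (c = a ∧ b = d + 1))
    (x y : ℕ) : ({v | A (x, y) v}.ncard : ℤ) =
      leftEdge A x y + leftEdge A (x + 1) y + lowerEdge A x y + lowerEdge A x (y + 1) := by
  classical
  have hs (u v : ℕ × ℕ) : A u v ↔ A v u := ⟨hsymm u v, hsymm v u⟩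
  have key (s : Finset (ℕ × ℕ)) (h : ∀ v, A (x, y) v → v ∈ s) :
      ({v | A (x, y) v}.ncard : ℤ) = ∑ v ∈ s, if A (x, y) v then 1 else 0 := by
    rw [← Finset.natCast_card_filter, ← Set.ncard_coe_finset]
    congr 2
    ext v
    simpa using h v
  rcases x with _ | x <;> rcases y with _ | y
  · rw [key {(0 + 1, 0), (0, 0 + 1)}]
    · simp [-Finset.sum_boole, leftEdge, lowerEdge]
    · rintro ⟨c, d⟩ h
      have := hgrid _ _ _ _ h
      simp only [Finset.mem_insert, Finset.mem_singleton, Prod.mk.injEq]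
      omega
  · rw [key {(0 + 1, y + 1), (0, y), (0, y + 1 + 1)}]
    · simp [-Finset.sum_boole, leftEdge, lowerEdge, hs (0, y + 1) (0, y), add_assoc]
    · rintro ⟨c, d⟩ h
      have := hgrid _ _ _ _ h
      simp only [Finset.mem_insert, Finset.mem_singleton, Prod.mk.injEq]
      omega
  · rw [key {(x, 0), (x + 1 + 1, 0), (x + 1, 0 + 1)}]
    · simp [-Finset.sum_boole, leftEdge, lowerEdge, hs (x + 1, 0) (x, 0), add_assoc]
    · rintro ⟨c, d⟩ h
      have := hgrid _ _ _ _ h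
      simp only [Finset.mem_insert, Finset.mem_singleton, Prod.mk.injEq]
      omega
  · rw [key {(x, y + 1), (x + 1 + 1, y + 1), (x + 1, y), (x + 1, y + 1 + 1)}]
    · simp [-Finset.sum_boole, leftEdge, lowerEdge, hs (x + 1, y + 1) (x, y + 1), hs (x + 1, y + 1) (x + 1, y),
        add_assoc]
    · rintro ⟨c, d⟩ h
      have := hgrid _ _ _ _ h
      simp only [Finset.mem_insert, Finset.mem_singleton, Prod.mk.injEq]
      omega

/-- Induction along a word `l` from the right, where the motive knows the position `x` and the
length `c` of the run of `1`s that ends just before `x`, up to whether it is `0`. -/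
theorem run_induction {l : List (Fin 2)} {M : ℕ → ℕ → List (Fin 2) → Prop}
    (nil : ∀ c, (c ≠ 0 ↔ ∃ i, l.length = i + 1 ∧ l[i]? = some 1) → M l.length c [])
    (zero : ∀ x c m, x < l.length → l[x]? = some 0 →
      (c ≠ 0 ↔ ∃ i, x = i + 1 ∧ l[i]? = some 1) → M (x + 1) 0 m → M x c (0 :: m))
    (one : ∀ x c m, x < l.length → l[x]? = some 1 →
      (c ≠ 0 ↔ ∃ i, x = i + 1 ∧ l[i]? = some 1) → M (x + 1) (c + 1) m → M x c (1 :: m)) :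
    M 0 0 l := by
  have key (m : List (Fin 2)) : ∀ x c, l.drop x = m → x ≤ l.length →
      (c ≠ 0 ↔ ∃ i, x = i + 1 ∧ l[i]? = some 1) → M x c m := by
    induction m with
    | nil =>
      intro x c hd hx hc
      obtain rfl : x = l.length := le_antisymm hx (List.drop_eq_nil_iff.1 hd)
      exact nil c hc
    | cons a m ih =>
      intro x c hd hx hc
      have hlt : x < l.length := by
        by_contra h
        rw [List.drop_eq_nil_iff.2 (by omega)] at hd
        cases hd
      have hget : l[x]? = some a := by
        have := congrArg (·[0]?) hd
        simpa using this
      have hd' : l.drop (x + 1) = m := by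
        rw [← List.drop_drop, hd]
        rfl
      obtain rfl | rfl : a = 0 ∨ a = 1 := by omega
      · exact zero x c m hlt hget hc (ih _ _ hd' hlt (by simp [hget]))
      · exact one x c m hlt hget hc (ih _ _ hd' hlt (by simp [hget]))
  exact key l 0 0 (by simp) (by simp) (by simp)

/-- Invariant: after `c` ones of the current run, `S x` is 2 for odd `c` and 0 for even `c`. If a
nonempty run ended with `c` even, `htouch` would give `S (x + 1) = 2`, against `hle` or, at the end
of the word, `hend`. -/
theorem runsIn_odd_of_alternating {l : List (Fin 2)} {S : ℕ → ℤ} (h0 : S 0 = 0)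
    (hend : S (l.length + 1) = 0)
    (hle : ∀ x < l.length, l[x]? ≠ some 1 → S (x + 1) ≤ 1)
    (htouch : ∀ x ≤ l.length, (l[x]? = some 1 ∨ ∃ i, x = i + 1 ∧ l[i]? = some 1) →
      S x + S (x + 1) = 2)
    (hfree : ∀ x ≤ l.length, ¬ (l[x]? = some 1 ∨ ∃ i, x = i + 1 ∧ l[i]? = some 1) →
      S x + S (x + 1) = 0) :
    RunsIn (fun c => c = 0 ∨ Odd c) 0 l := by
  refine run_induction (l := l) (M := fun x c m => S x = (if Odd c then 2 else 0) →
    RunsIn (fun c => c = 0 ∨ Odd c) c m) ?_ ?_ ?_ (by simpa using h0)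
  · intro c hc hS
    by_cases h : c = 0
    · exact Or.inl h
    · have := htouch _ le_rfl (Or.inr (hc.1 h))
      refine Or.inr ?_
      by_contra hodd
      rw [if_neg hodd] at hS
      omega
  · intro x c m hx hget hc ih hS
    have h1 := hle x hx (by simp [hget])
    rw [runsIn_zero_cons]
    by_cases h : c = 0
    · have h2 := hfree x hx.le (by
        rw [← hc]
        simp [h, hget])
      refine ⟨Or.inl h, ih ?_⟩
      simp [h] at hS ⊢
      omega
    · have h2 := htouch x hx.le (Or.inr (hc.1 h))
      have hodd : Odd c := by
        by_contra hodd
        rw [if_neg hodd] at hS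
        omega
      refine ⟨Or.inr hodd, ih ?_⟩
      simp [hodd] at hS ⊢
      omega
  · intro x c m hx hget hc ih hS
    rw [runsIn_one_cons]
    have h2 := htouch x hx.le (Or.inl hget)
    refine ih ?_
    by_cases hodd : Odd c
    · rw [if_pos hodd] at hS
      rw [if_neg (by simpa [Nat.odd_add_one] using hodd)]
      omega
    · rw [if_neg hodd] at hS
      rw [if_pos (by simpa [Nat.odd_add_one] using hodd)]
      omega

/-- Only the fact that every vertex has degree 2 in the cycle is used, not connectedness. Degrees on
a line combine as `2 - 2 + 2` or `2 - 2`. -/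
theorem IsBargraph.runsIn_odd_of_isHamiltonianCycle {P : Finset (ℕ × ℕ)} {l : List (Fin 2)}
    (hP : IsBargraph P l) (hl : l ≠ []) {a : {v // v ∈ P.biUnion cellCorners}}
    {p : (polyominoGraph P).Walk a a} (hp : p.IsHamiltonianCycle) :
    RunsIn (fun c => c = 0 ∨ Odd c) 0 l := by
  have hlt (i : ℕ) (h : l[i]? = some 1) : i < l.length := (List.getElem?_eq_some_iff.1 h).1
  let A (u v : ℕ × ℕ) : Prop := ∃ hu hv, p.toSubgraph.Adj ⟨u, hu⟩ ⟨v, hv⟩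
  have hside (u v : ℕ × ℕ) (h : A u v) : s(u, v) ∈ P.biUnion cellSides := by
    obtain ⟨hu, hv, h⟩ := h
    exact h.adj_sub
  have hsymm (u v : ℕ × ℕ) (h : A u v) : A v u := by
    obtain ⟨hu, hv, h⟩ := h
    exact ⟨hv, hu, h.symm⟩
  have hgrid (a b c d : ℕ) (h : A (a, b) (c, d)) :
      (c = a + 1 ∧ d = b) ∨ (a = c + 1 ∧ d = b) ∨ (c = a ∧ d = b + 1) ∨ (c = a ∧ b = d + 1) := by
    have := hside _ _ h
    simp only [Finset.mem_biUnion, Prod.exists, mem_cellSides] at this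
    obtain ⟨i, r, -, h⟩ := this
    omega
  have hdeg (x y : ℕ) (h : (x, y) ∈ P.biUnion cellCorners) :
      leftEdge A x y + leftEdge A (x + 1) y + lowerEdge A x y + lowerEdge A x (y + 1) = 2 := by
    rw [← ncard_neighbors_eq hsymm hgrid]
    have h2 := hp.isCycle.ncard_neighborSet_toSubgraph_eq_two (hp.mem_support ⟨_, h⟩)
    rw [← Set.ncard_image_of_injective _ Subtype.val_injective] at h2
    rw [← Nat.cast_two, ← h2]
    congr 2
    ext v
    constructor
    · rintro ⟨hu, hv, h⟩
      exact ⟨⟨v, hv⟩, h, rfl⟩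
    · rintro ⟨w, h, rfl⟩
      exact ⟨_, w.2, h⟩
  have hleft (x y : ℕ) (h : ¬ ((x, y) ∈ P ∨ ∃ r, y = r + 1 ∧ (x, r) ∈ P)) :
      leftEdge A (x + 1) y = 0 :=
    if_neg fun h' => h (horizontal_mem_sides.1 (hside _ _ h'))
  have hlower (x y : ℕ) (h : ¬ ((x, y) ∈ P ∨ ∃ i, x = i + 1 ∧ (i, y) ∈ P)) :
      lowerEdge A x (y + 1) = 0 :=
    if_neg fun h' => h (vertical_mem_sides.1 (hside _ _ h'))
  have hleft_two (x : ℕ) (h : l[x]? ≠ some 1) : leftEdge A (x + 1) 2 = 0 :=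
    hleft _ _ (by simp [IsBargraph] at hP; simp [hP, h])
  have hleft_nonneg (x y : ℕ) : 0 ≤ leftEdge A x y := by
    cases x <;> simp only [leftEdge, le_refl]
    split_ifs <;> simp
  have hleft_le (x y : ℕ) : leftEdge A x y ≤ 1 := by
    cases x <;> simp only [leftEdge, zero_le_one]
    split_ifs <;> simp
  have hlower_three (x : ℕ) : lowerEdge A x 3 = 0 := hlower _ _ (by simp [hP _ _])
  have hcorner := fun x y => hP.mem_corners hl (x := x) (y := y)
  refine runsIn_odd_of_alternating
    (S := fun x => leftEdge A x 0 - leftEdge A x 1 + leftEdge A x 2) (by simp [leftEdge]) ?_ ?_ ?_ ?_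
  · have (y : ℕ) : leftEdge A (l.length + 1) y = 0 := hleft _ _ (by simp [hP _ _])
    simp [this]
  -- Above a column of height 1 there is no edge at height 2, so only the bottom edge counts
  -- positively.
  · intro x _ h
    have := hleft_two x h
    have := hleft_nonneg (x + 1) 1
    have := hleft_le (x + 1) 0
    omega
  · intro x hx h
    have h0 := hdeg x 0 ((hcorner x 0).2 (by omega))
    have h1 := hdeg x 1 ((hcorner x 1).2 (by omega))
    have h2 := hdeg x 2 ((hcorner x 2).2 (Or.inr ⟨rfl, h⟩))
    have h3 := hlower_three x
    simp only [lowerEdge] at h0 h1 h2 h3 ⊢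
    omega
  · intro x hx h
    have h0 := hdeg x 0 ((hcorner x 0).2 (by omega))
    have h1 := hdeg x 1 ((hcorner x 1).2 (by omega))
    push Not at h
    have h2 : leftEdge A x 2 = 0 := by
      cases x with
      | zero => rfl
      | succ x => exact hleft_two x (h.2 x rfl)
    have h2' := hleft_two x h.1
    have h3 : lowerEdge A x 2 = 0 := hlower _ _ (by
      rintro (h' | ⟨i, rfl, h'⟩)
      · simp [hP _ _, h.1] at h'
      · simp [hP _ _, h.2 i rfl] at h')
    simp only [lowerEdge] at h0 h1 h3 ⊢
    omega

/-! ### Sufficiency: an explicit Hamiltonian cycle -/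

theorem SimpleGraph.exists_isHamiltonianCycle_of_list {V : Type*} [DecidableEq V]
    (G : SimpleGraph V) (L : List V) (hlen : 3 ≤ L.length) (hnodup : L.Nodup)
    (hchain : L.IsChain G.Adj) (hmem : ∀ v, v ∈ L) {u v : V} (hu : L.head? = some u)
    (hv : L.getLast? = some v) (hadj : G.Adj v u) :
    ∃ (a : V) (p : G.Walk a a), p.IsHamiltonianCycle := by
  have hne : L ≠ [] := by rintro rfl; simp at hlen
  obtain rfl : L.head hne = u := by simpa [List.head?_eq_some_head hne] using hu
  obtain rfl : L.getLast hne = v := by simpa [List.getLast?_eq_some_getLast hne] using hv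
  have hsupp := SimpleGraph.Walk.support_ofSupport hne hchain
  have hlength := SimpleGraph.Walk.length_ofSupport hne hchain
  have hpath : (SimpleGraph.Walk.ofSupport L hne hchain).IsPath :=
    SimpleGraph.Walk.IsPath.mk' (by rwa [hsupp])
  refine ⟨_, .cons hadj (.ofSupport L hne hchain), ?_⟩
  rw [SimpleGraph.Walk.isHamiltonianCycle_iff_isCycle_and_support_count_tail_eq_one,
    SimpleGraph.Walk.cons_isCycle_iff]
  refine ⟨⟨hpath, fun h => ?_⟩, fun a => ?_⟩
  -- A path containing the edge between its endpoints is that single edge, but here there are at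
  -- least three vertices.
  · have := hpath.length_eq_one_of_mem_edges (Sym2.eq_swap ▸ h)
    omega
  · rw [SimpleGraph.Walk.support_cons, List.tail_cons, hsupp]
    exact List.count_eq_one_of_mem hnodup (hmem a)

/-- The zigzag through the vertices of height at least `1` of the bargraph of a word, from the
position `x` on, where `c` is the length of the run of `1`s that ends just before `x`. -/
def capPath : ℕ → ℕ → List (Fin 2) → List (ℕ × ℕ)
  | x, c, [] => if Even c then [(x, 1)] else [(x, 2), (x, 1)]
  | x, c, a :: l =>
    if a = 1 then
      if Even c then (x, 1) :: (x, 2) :: capPath (x + 1) (c + 1) l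
      else (x, 2) :: (x, 1) :: capPath (x + 1) (c + 1) l
    else
      if Even c then (x, 1) :: capPath (x + 1) 0 l
      else (x, 2) :: (x, 1) :: capPath (x + 1) 0 l

/-- The zigzag enters line `x` at height 1 if `c` is even and at height 2 if `c` is odd. A run of
odd length therefore ends by descending through both vertices of its last line; a nonzero even run
would miss the upper one. -/
theorem capPath_spec {l : List (Fin 2)} {R : ℕ × ℕ → ℕ × ℕ → Prop}
    (hmid : ∀ x < l.length, R (x, 1) (x + 1, 1))
    (htop : ∀ x, l[x]? = some 1 → R (x, 2) (x + 1, 2))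
    (hvert : ∀ x, (l[x]? = some 1 ∨ ∃ i, x = i + 1 ∧ l[i]? = some 1) →
      R (x, 1) (x, 2) ∧ R (x, 2) (x, 1))
    (hl : RunsIn (fun c => c = 0 ∨ Odd c) 0 l) :
    (∀ a b, (a, b) ∈ capPath 0 0 l ↔ b = 1 ∧ a ≤ l.length ∨
      b = 2 ∧ (l[a]? = some 1 ∨ ∃ i, a = i + 1 ∧ l[i]? = some 1)) ∧
    (capPath 0 0 l).Nodup ∧ (capPath 0 0 l).IsChain R ∧
    (capPath 0 0 l).head? = some (0, 1) ∧ (capPath 0 0 l).getLast? = some (l.length, 1) := by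
  have hlt (i : ℕ) (h : l[i]? = some 1) : i < l.length := (List.getElem?_eq_some_iff.1 h).1
  have key : RunsIn (fun c => c = 0 ∨ Odd c) 0 l →
      (∀ a b, (a, b) ∈ capPath 0 0 l ↔ b = 1 ∧ 0 ≤ a ∧ a ≤ l.length ∨
        b = 2 ∧ 0 ≤ a ∧ (l[a]? = some 1 ∨ ∃ i, a = i + 1 ∧ l[i]? = some 1)) ∧
      (capPath 0 0 l).Nodup ∧ (capPath 0 0 l).IsChain R ∧
      (capPath 0 0 l).head? = some (0, if Even 0 then 1 else 2) ∧
      (capPath 0 0 l).getLast? = some (l.length, 1) := by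
    refine run_induction (l := l) (M := fun x c m => RunsIn (fun c => c = 0 ∨ Odd c) c m →
      (∀ a b, (a, b) ∈ capPath x c m ↔ b = 1 ∧ x ≤ a ∧ a ≤ l.length ∨
        b = 2 ∧ x ≤ a ∧ (l[a]? = some 1 ∨ ∃ i, a = i + 1 ∧ l[i]? = some 1)) ∧
      (capPath x c m).Nodup ∧ (capPath x c m).IsChain R ∧
      (capPath x c m).head? = some (x, if Even c then 1 else 2) ∧
      (capPath x c m).getLast? = some (l.length, 1)) ?_ ?_ ?_
    · intro c hc hgood
      have hbound (a : ℕ) (ha : l.length ≤ a)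
          (h : l[a]? = some 1 ∨ ∃ i, a = i + 1 ∧ l[i]? = some 1) : a = l.length ∧ c ≠ 0 := by
        obtain h | ⟨i, rfl, h⟩ := h
        · have := hlt _ h; omega
        · have := hlt _ h
          obtain h' : l.length = i + 1 := by omega
          exact ⟨h'.symm, hc.2 ⟨i, h', h⟩⟩
      obtain rfl | hodd := hgood
      · simp only [capPath, Even.zero, if_true, List.mem_singleton, Prod.mk.injEq]
        refine ⟨fun a b => ⟨fun h => by omega, ?_⟩, by simp, by simp, by simp, by simp⟩
        rintro (h | ⟨rfl, h, h'⟩)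
        · omega
        · exact absurd rfl (hbound a h h').2
      · have hne : c ≠ 0 := by rintro rfl; simp at hodd
        have hT := hc.1 hne
        have hR := hvert _ (Or.inr hT)
        simp only [capPath, Nat.not_even_iff_odd.2 hodd, if_false, List.mem_cons,
          Prod.mk.injEq, List.not_mem_nil, or_false]
        refine ⟨fun a b => ⟨?_, ?_⟩, by simp, by simp [hR.2], by simp, by simp⟩
        · rintro (⟨rfl, rfl⟩ | ⟨rfl, rfl⟩)
          · exact Or.inr ⟨rfl, le_rfl, Or.inr hT⟩
          · exact Or.inl ⟨rfl, le_rfl, le_rfl⟩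
        · rintro (h | ⟨rfl, h, h'⟩)
          · omega
          · exact Or.inl ⟨(hbound a h h').1, rfl⟩
    · intro x c m hx hget hc ih hgood
      rw [runsIn_zero_cons] at hgood
      obtain ⟨hmem, hnodup, hchain, hhead, hlast⟩ := ih hgood.2
      have hne : l[x]? ≠ some 1 := by simp [hget]
      obtain rfl | hodd := hgood.1
      · simp only [capPath, Even.zero, if_true, zero_ne_one, if_false, List.mem_cons,
          Prod.mk.injEq, hmem, List.nodup_cons, List.isChain_cons, hhead, List.getLast?_cons,
          hlast, hnodup, hchain]
        refine ⟨fun a b => ⟨?_, ?_⟩, by simp, by simp [hmid x hx], by simp, by simp⟩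
        · rintro (⟨rfl, rfl⟩ | ⟨rfl, h⟩ | ⟨rfl, h, h'⟩)
          · omega
          · omega
          · exact Or.inr ⟨rfl, by omega, h'⟩
        · rintro (h | ⟨rfl, h, h'⟩)
          · omega
          · obtain h | rfl := h.lt_or_eq
            · exact Or.inr (Or.inr ⟨rfl, h, h'⟩)
            -- With `c = 0` and letter `0`, no `1` touches line `x`, so `(x, 2)` is not a vertex.
            · rw [← hc] at h'
              simp [hne] at h'
      · have hT := hc.1 (by rintro rfl; simp at hodd)
        have hR := hvert _ (Or.inr hT)
        simp only [capPath, Nat.not_even_iff_odd.2 hodd, if_true, zero_ne_one, if_false,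
          List.mem_cons, Prod.mk.injEq, hmem, List.nodup_cons, List.isChain_cons, hhead,
          List.getLast?_cons, hlast, hnodup, hchain, Even.zero]
        refine ⟨fun a b => ⟨?_, ?_⟩, by simp, by simp [hmid x hx, hR], by simp, by simp⟩
        · rintro (⟨rfl, rfl⟩ | ⟨rfl, rfl⟩ | ⟨rfl, h⟩ | ⟨rfl, h, h'⟩)
          · exact Or.inr ⟨rfl, le_rfl, Or.inr hT⟩
          · omega
          · omega
          · exact Or.inr ⟨rfl, by omega, h'⟩
        · rintro (h | ⟨rfl, h, h'⟩)
          · omega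
          · obtain h | rfl := h.lt_or_eq
            · exact Or.inr (Or.inr (Or.inr ⟨rfl, h, h'⟩))
            · exact Or.inl ⟨rfl, rfl⟩
    · intro x c m hx hget hc ih hgood
      rw [runsIn_one_cons] at hgood
      obtain ⟨hmem, hnodup, hchain, hhead, hlast⟩ := ih hgood
      have hR := hvert _ (Or.inl hget)
      have hmem' (a b : ℕ) : (a = x ∧ b = 1 ∨ a = x ∧ b = 2 ∨
          (b = 1 ∧ x + 1 ≤ a ∧ a ≤ l.length ∨ b = 2 ∧ x + 1 ≤ a ∧
            (l[a]? = some 1 ∨ ∃ i, a = i + 1 ∧ l[i]? = some 1))) ↔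
          b = 1 ∧ x ≤ a ∧ a ≤ l.length ∨ b = 2 ∧ x ≤ a ∧
            (l[a]? = some 1 ∨ ∃ i, a = i + 1 ∧ l[i]? = some 1) := by
        constructor
        · rintro (⟨rfl, rfl⟩ | ⟨rfl, rfl⟩ | ⟨rfl, h⟩ | ⟨rfl, h, h'⟩)
          · omega
          · exact Or.inr ⟨rfl, le_rfl, Or.inl hget⟩
          · omega
          · exact Or.inr ⟨rfl, by omega, h'⟩
        · rintro (h | ⟨rfl, h, h'⟩)
          · omega
          · obtain h | rfl := h.lt_or_eq
            · exact Or.inr (Or.inr (Or.inr ⟨rfl, h, h'⟩))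
            · exact Or.inr (Or.inl ⟨rfl, rfl⟩)
      by_cases hc : Even c
      · have hc' : ¬ Even (c + 1) := by simpa [Nat.even_add_one] using hc
        simp only [capPath, hc, hc', if_true, if_false, List.mem_cons, Prod.mk.injEq, hmem,
          List.nodup_cons, List.isChain_cons, hhead, List.getLast?_cons, hlast, hnodup,
          hchain]
        exact ⟨hmem', by simp, by simp [htop x hget, hR], by simp, by simp⟩
      · have hc' : Even (c + 1) := by simpa [Nat.even_add_one] using hc
        simp only [capPath, hc, hc', if_true, if_false, List.mem_cons, Prod.mk.injEq, hmem,
          List.nodup_cons, List.isChain_cons, hhead, List.getLast?_cons, hlast, hnodup,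
          hchain]
        exact ⟨fun a b => by rw [← hmem', or_left_comm], by simp, by simp [hmid x hx, hR],
          by simp, by simp⟩
  simpa using key hl

theorem IsBargraph.exists_isHamiltonianCycle {P : Finset (ℕ × ℕ)} {l : List (Fin 2)}
    (hP : IsBargraph P l) (hl : l ≠ []) (hruns : RunsIn (fun c => c = 0 ∨ Odd c) 0 l) :
    ∃ (a : _) (p : (polyominoGraph P).Walk a a), p.IsHamiltonianCycle := by
  let R (u v : ℕ × ℕ) : Prop := s(u, v) ∈ P.biUnion cellSides
  have hsymm (u v : ℕ × ℕ) (h : R u v) : R v u := by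
    simpa only [R, Sym2.eq_swap] using h
  have hhor (x : ℕ) (hx : x < l.length) : R (x, 0) (x + 1, 0) ∧ R (x, 1) (x + 1, 1) :=
    ⟨horizontal_mem_sides.2 (Or.inl ((hP _ _).2 (Or.inl ⟨rfl, hx⟩))),
      horizontal_mem_sides.2 (Or.inr ⟨0, rfl, (hP _ _).2 (Or.inl ⟨rfl, hx⟩)⟩)⟩
  have hpos := List.length_pos_iff.2 hl
  have hside (x : ℕ) (hx : x ≤ l.length) : R (x, 0) (x, 1) := by
    refine vertical_mem_sides.2 ?_
    obtain h | h := hx.lt_or_eq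
    · exact Or.inl ((hP _ _).2 (Or.inl ⟨rfl, h⟩))
    · exact Or.inr ⟨x - 1, by omega, (hP _ _).2 (Or.inl ⟨rfl, by omega⟩)⟩
  obtain ⟨hmem, hnodup, hchain, hhead, hlast⟩ := capPath_spec (R := R) (fun x hx => (hhor x hx).2)
    (fun x hx => horizontal_mem_sides.2 (Or.inr ⟨1, rfl, (hP _ _).2 (Or.inr ⟨rfl, hx⟩)⟩))
    (fun x hx => by
      have : R (x, 1) (x, 2) := by
        refine vertical_mem_sides.2 (hx.imp (fun h => ?_) ?_)
        · exact (hP _ _).2 (Or.inr ⟨rfl, h⟩)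
        · rintro ⟨i, rfl, h⟩
          exact ⟨i, rfl, (hP _ _).2 (Or.inr ⟨rfl, h⟩)⟩
      exact ⟨this, hsymm _ _ this⟩) hruns
  -- The zigzag from `(0, 1)` to the right end, then the bottom row back to `(0, 0)`; the side from
  -- `(0, 0)` to `(0, 1)` closes the cycle.
  let L := capPath 0 0 l ++ ((List.range (l.length + 1)).map fun x => (x, 0)).reverse
  have hL (v : ℕ × ℕ) : v ∈ L ↔ v ∈ P.biUnion cellCorners := by
    obtain ⟨a, b⟩ := v
    rw [hP.mem_corners hl]
    simp only [L, List.mem_append, hmem, List.mem_reverse, List.mem_map, List.mem_range,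
      Prod.mk.injEq]
    generalize (l[a]? = some 1 ∨ ∃ i, a = i + 1 ∧ l[i]? = some 1) = T
    constructor
    · rintro ((h | h) | h)
      · omega
      · exact Or.inr h
      · obtain ⟨x, hx, rfl, rfl⟩ := h
        omega
    · rintro (⟨h, h'⟩ | h)
      · obtain rfl | rfl : b = 0 ∨ b = 1 := by omega
        · exact Or.inr ⟨a, by omega, rfl, rfl⟩
        · exact Or.inl (Or.inl ⟨rfl, h'⟩)
      · exact Or.inl (Or.inr h)
  have hLnodup : L.Nodup := by
    refine hnodup.append ?_ ?_
    · exact List.nodup_reverse.2 (List.nodup_range.map fun x y h => by simpa using h)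
    · rintro ⟨a, b⟩ h h'
      rw [hmem] at h
      simp only [List.mem_reverse, List.mem_map, List.mem_range, Prod.mk.injEq] at h'
      omega
  have hLchain : L.IsChain R := by
    refine List.isChain_append.2 ⟨hchain, ?_, ?_⟩
    · rw [List.isChain_reverse, List.isChain_map, List.isChain_range_succ]
      exact fun x hx => hsymm _ _ (hhor x hx).1
    · simpa [hlast, List.range_succ] using hsymm _ _ (hside _ le_rfl)
  have hLhead : L.head? = some (0, 1) := by simp [L, hhead]
  have hLlast : L.getLast? = some (0, 0) := by simp [L, List.range_succ_eq_map]
  have hLlen : 3 ≤ L.length := by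
    have h1 : 1 ≤ (capPath 0 0 l).length := by
      rw [Nat.one_le_iff_ne_zero, Ne, List.length_eq_zero_iff]
      intro h
      simp [h] at hhead
    simp only [L, List.length_append, List.length_reverse, List.length_map, List.length_range]
    omega
  clear_value L
  lift L to List {v : ℕ × ℕ // v ∈ P.biUnion cellCorners} using fun v hv => (hL v).1 hv
  have hmemL (v) : v ∈ L := by
    have := (hL v).2 v.2
    rw [List.mem_map] at this
    obtain ⟨w, hw, h⟩ := this
    exact Subtype.ext h ▸ hw
  have hu : (0, 1) ∈ P.biUnion cellCorners := (hL _).1 (List.mem_of_mem_head? (by simp [hLhead]))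
  have hv : (0, 0) ∈ P.biUnion cellCorners := (hL _).1 (List.mem_of_getLast? hLlast)
  rw [List.head?_map, Option.map_eq_some_iff] at hLhead
  rw [List.getLast?_map, Option.map_eq_some_iff] at hLlast
  obtain ⟨u, hu, hu'⟩ := hLhead
  obtain ⟨v, hv, hv'⟩ := hLlast
  refine (polyominoGraph P).exists_isHamiltonianCycle_of_list L (by simpa using hLlen)
    hLnodup.of_map ((List.isChain_map (R := R) Subtype.val).1 hLchain) hmemL hu hv ?_
  change R v u
  rw [hu', hv']
  exact hside 0 (Nat.zero_le _)
-- From words to the generating function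
theorem mem_wordPolyomino {n : ℕ} {w : Fin n → Fin 2} {i r : ℕ} :
    (i, r) ∈ wordPolyomino w ↔ ∃ h : i < n, r ≤ w ⟨i, h⟩ := by
  simp only [wordPolyomino, Finset.mem_biUnion, Finset.mem_univ, true_and, Finset.mem_image,
    Finset.mem_range, Prod.mk.injEq]
  constructor
  · rintro ⟨j, s, hs, rfl, rfl⟩
    exact ⟨j.2, by simpa using Nat.lt_succ_iff.1 hs⟩
  · rintro ⟨h, hr⟩
    exact ⟨⟨i, h⟩, r, by omega, rfl, rfl⟩

/-- Column heights recover the word, so summing over polyominoes counts every word once. -/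
theorem wordPolyomino_injective (n : ℕ) :
    Function.Injective (wordPolyomino : (Fin n → Fin 2) → _) := by
  intro v w h
  ext i
  have key (r : ℕ) : r ≤ v i ↔ r ≤ w i := by
    have := Finset.ext_iff.1 h (i, r)
    simpa [mem_wordPolyomino] using this
  exact le_antisymm ((key _).1 le_rfl) ((key _).2 le_rfl)

theorem isBargraph_wordPolyomino {n : ℕ} (w : Fin n → Fin 2) :
    IsBargraph (wordPolyomino w) (List.ofFn w) := by
  intro i r
  rw [mem_wordPolyomino, List.length_ofFn, List.getElem?_ofFn]
  by_cases h : i < n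
  · simp only [h, exists_true_left, and_true, dif_pos, Option.some.injEq]
    generalize w ⟨i, h⟩ = a
    obtain rfl | rfl : a = 0 ∨ a = 1 := by omega
    · simp
    · simp [Nat.le_one_iff_eq_zero_or_eq_one]
  · simp [h]

theorem hamIndicator_wordPolyomino {n : ℕ} (hn : n ≠ 0) (w : Fin n → Fin 2)
    [Decidable (RunsIn (fun c => c = 0 ∨ Odd c) 0 (List.ofFn w))] :
    hamIndicator (polyominoGraph (wordPolyomino w)) =
      if RunsIn (fun c => c = 0 ∨ Odd c) 0 (List.ofFn w) then 1 else 0 := by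
  have hP := isBargraph_wordPolyomino w
  have hl : List.ofFn w ≠ [] := by simpa [List.ofFn_eq_nil_iff] using hn
  unfold hamIndicator
  congr 1
  exact propext ⟨fun ⟨_, _, hp⟩ => hP.runsIn_odd_of_isHamiltonianCycle hl hp,
    hP.exists_isHamiltonianCycle hl⟩

/-- Apply `q ^ Ham = 1 + (q - 1) * Ham` word by word; the subtracted 1s remove the empty word. -/
theorem hamiltonianGF_eq (k : ℕ) (hk : 1 ≤ k) :
    hamiltonianGF k = (runGF (· < k) 0 - 1) + (PowerSeries.C Polynomial.X - 1) *
      (runGF (fun c => c < k ∧ (c = 0 ∨ Odd c)) 0 - 1) := by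
  classical
  ext1 n
  by_cases hn : n = 0
  · subst hn
    have h : 0 < k := hk
    simp [hamiltonianGF, runGF, runCount_zero, h]
  · have hsum : ∑ P ∈ kBonacciPolyominoes n k,
        (Polynomial.X : Polynomial ℤ) ^ hamIndicator (polyominoGraph P) =
        ∑ w : Fin n → Fin 2, ((if RunsIn (· < k) 0 (List.ofFn w) then 1 else 0) +
          (Polynomial.X - 1) * if RunsIn (fun c => c < k ∧ (c = 0 ∨ Odd c)) 0 (List.ofFn w)
            then 1 else 0) := by
      rw [kBonacciPolyominoes, Finset.sum_image (wordPolyomino_injective n).injOn]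
      have : kBonacciWords n k =
          Finset.univ.filter fun w => RunsIn (· < k) 0 (List.ofFn w) := by
        ext w; simp [mem_kBonacciWords]
      rw [this, Finset.sum_filter]
      refine Finset.sum_congr rfl fun w _ => ?_
      rw [hamIndicator_wordPolyomino hn, RunsIn.and_iff]
      split_ifs <;> simp_all
    rw [sub_mul, one_mul, ← map_one PowerSeries.C]
    simp only [map_add, map_sub, PowerSeries.coeff_C_mul, hamiltonianGF, runGF,
      PowerSeries.coeff_mk, hn, if_false, hsum, runCount, Finset.card_filter,
      PowerSeries.coeff_C, Finset.sum_add_distrib, ← Finset.mul_sum]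
    push_cast
    ring

theorem mainTheorem4 (k : ℕ) (hk : 2 ≤ k)
    (x q N D : PowerSeries (Polynomial ℤ))
    (hx : x = PowerSeries.X)
    (hq : q = PowerSeries.C (Polynomial.X : Polynomial ℤ))
    (hN : N = x * ((1 - x) * x * (1 - x ^ (2 * ((k - 1) / 2)))
      - q * (1 + x) * (1 - 2 * x + x ^ (k + 1)) * (-2 + x + x ^ (2 * (k / 2)))))
    (hD : D = (1 - 2 * x + x ^ (k + 1))
      * (1 - x - 2 * x ^ 2 + x ^ 3 + x ^ (2 * (1 + k / 2)))) :
    IsUnit D ∧ hamiltonianGF k * D = N := by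
  constructor
  · rw [PowerSeries.isUnit_iff_constantCoeff]
    simp [hD, hx, mul_add]
  · have h₁ := runGF_lt_mul k
    have h₂ := runGF_odd_mul k (by omega)
    rw [hamiltonianGF_eq k (by omega), hN, hD]
    rw [← hx] at h₁ h₂
    rw [← hq]
    generalize runGF (· < k) 0 = T at *
    generalize runGF (fun c => c < k ∧ (c = 0 ∨ Odd c)) 0 = M at *
    -- The parity of `k` determines both floors, making the claim a polynomial combination of `h₁`
    -- and `h₂`.
    obtain ⟨m, rfl | rfl⟩ := k.even_or_odd'
    · obtain ⟨m, rfl⟩ := Nat.exists_eq_add_of_le' (show 1 ≤ m by omega)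
      rw [show (2 * (m + 1) - 1) / 2 = m by omega]
      rw [show 2 * (m + 1) / 2 = m + 1 by omega] at h₂ ⊢
      linear_combination (1 - x - 2 * x ^ 2 + x ^ 3 + x ^ (2 * (1 + (m + 1)))) * h₁
        + (q - 1) * (1 - 2 * x + x ^ (2 * (m + 1) + 1)) * h₂
    · rw [show (2 * m + 1 - 1) / 2 = m by omega]
      rw [show (2 * m + 1) / 2 = m by omega] at h₂ ⊢
      linear_combination (1 - x - 2 * x ^ 2 + x ^ 3 + x ^ (2 * (1 + m))) * h₁
        + (q - 1) * (1 - 2 * x + x ^ (2 * m + 1 + 1)) * h₂
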